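/- Let $n\ge 1$, let $m=n(n+1)/2$, let $\mathrm{Sym}(n)$ be the space of real symmetric $n\times n$ matrices and $\mathrm{SPD}(n)\subset\mathrm{Sym}(n)$ the open subset of positive definite ones. Equip $\mathrm{SPD}(n)$ with the affine-invariant Riemannian metric $\langle V,W\rangle_P=\mathrm{Tr}(P^{-1}VP^{-1}W)$, for which, for $P,Q\in\mathrm{SPD}(n)$ and $V\in\mathrm{Sym}(n)$, $$\exp_P(V)=P^{1/2}\exp(P^{-1/2}VP^{-1/2})P^{1/2},\qquad \log_P(Q)=P^{1/2}\log(P^{-1/2}QP^{-1/2})P^{1/2},$$ $$d(P,Q)^2=\mathrm{Tr}\big(\log(P^{-1/2}QP^{-1/2})^2\big).$$ For $r>0$ put $\mathrm{SPD}_r(n)=\{P\in\mathrm{SPD}(n):\det P=r\}$. For $R_1,\dots,R_m\in\mathrm{SPD}(n)$ define: - the Fréchet map $F:\mathrm{SPD}(n)\to\mathbb R^m$, $F(P)=(d(R_1,P)^2,\dots,d(R_m,P)^2)$; - $S_{R_1,\dots,R_m}$, the set of all $P\in\mathrm{SPD}(n)$ at which the family $(\log_P R_1,\dots,\log_P R_m)$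 does not have rank $m$; - the exponential barycentric subspace $\mathrm{EBS}(R_1,\dots,R_m)$, the set of all $P\in\mathrm{SPD}(n)$ for which there is $\lambda\in\mathbb R^m$ with $\sum_{i=1}^m\lambda_i=1$ such that $P$ is a critical point of $Q\mapsto\sum_{i=1}^m\lambda_i\,d(R_i,Q)^2$. **Theorem.** Let $r>0$ and $R_1,\dots,R_m\in\mathrm{SPD}_r(n)$. Then $$\mathrm{EBS}(R_1,\dots,R_m)\subseteq\mathrm{SPD}_r(n)\subseteq S_{R_1,\dots,R_m}.$$ Moreover, these three sets are all equal unless there exist $P\in\mathrm{SPD}_r(n)$ and an affine subspace $H$ of $\mathrm{Sym}(n)$ of dimension at most $m-2$ such that $R_1,\dots,R_m\in\exp_P(H)$. Whenever the three sets are equal (in particular, whenever there are no such $P$ and $H$), $F$ is an immersion (smooth with injective differential at every point) on each of the two open sets $\{P\in\mathrm{SPD}(n):\det P>r\}$ and $\{P\in\mathrm{SPD}(n):\det P<r\}$. -/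

import Mathlib

open scoped Matrix ContDiff

attribute [local instance] Matrix.normedAddCommGroup Matrix.normedSpace

noncomputable section

/-- `Sym(n)`, the real vector space of symmetric `n × n` matrices. The norm on it is the
entrywise sup norm; as the space is finite-dimensional, differentiability and smoothness do not
depend on the choice of norm. -/
abbrev SymMat (n : ℕ) : Submodule ℝ (Matrix (Fin n) (Fin n) ℝ) where
  carrier := {A | A.IsSymm}
  add_mem' := fun hA hB => hA.add hB
  zero_mem' := Matrix.isSymm_zero
  smul_mem' := fun c _ hA => hA.smul c

/-- `SPD(n)`, as a subset of `Sym(n)`. -/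
def SPD (n : ℕ) : Set (SymMat n) := {P | (P : Matrix (Fin n) (Fin n) ℝ).PosDef}

/-- The level hypersurface `SPD_r(n) = {P ∈ SPD(n) : det P = r}`. -/
def SPDLevel (n : ℕ) (r : ℝ) : Set (SymMat n) :=
  {P | P ∈ SPD n ∧ (P : Matrix (Fin n) (Fin n) ℝ).det = r}

/-- The halfspace `{P ∈ SPD(n) : det P > r}`. -/
def SPDUpper (n : ℕ) (r : ℝ) : Set (SymMat n) :=
  {P | P ∈ SPD n ∧ r < (P : Matrix (Fin n) (Fin n) ℝ).det}

/-- The halfspace `{P ∈ SPD(n) : det P < r}`. -/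
def SPDLower (n : ℕ) (r : ℝ) : Set (SymMat n) :=
  {P | P ∈ SPD n ∧ (P : Matrix (Fin n) (Fin n) ℝ).det < r}

/-- The square root `P^{1/2}` of a positive (semi)definite matrix. -/
def matSqrt {n : ℕ} (P : Matrix (Fin n) (Fin n) ℝ) : Matrix (Fin n) (Fin n) ℝ :=
  cfc Real.sqrt P

/-- The matrix logarithm of a symmetric positive definite matrix. -/
def matLog {n : ℕ} (P : Matrix (Fin n) (Fin n) ℝ) : Matrix (Fin n) (Fin n) ℝ :=
  cfc Real.log P

theorem isSymm_iff_isHermitian_real {n : ℕ} (A : Matrix (Fin n) (Fin n) ℝ) :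
    A.IsSymm ↔ A.IsHermitian := by
  rw [Matrix.IsSymm, Matrix.IsHermitian, Matrix.conjTranspose_eq_transpose_of_trivial]

theorem matSqrt_isSymm {n : ℕ} (P : Matrix (Fin n) (Fin n) ℝ) : (matSqrt P).IsSymm :=
  (isSymm_iff_isHermitian_real _).2 (cfc_predicate Real.sqrt P)

theorem matLog_isSymm {n : ℕ} (P : Matrix (Fin n) (Fin n) ℝ) : (matLog P).IsSymm :=
  (isSymm_iff_isHermitian_real _).2 (cfc_predicate Real.log P)

theorem matSqrt_inv_isSymm {n : ℕ} (P : Matrix (Fin n) (Fin n) ℝ) : ((matSqrt P)⁻¹).IsSymm := by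
  rw [Matrix.IsSymm, Matrix.transpose_nonsing_inv, matSqrt_isSymm P]

theorem isSymm_conj {n : ℕ} {A B : Matrix (Fin n) (Fin n) ℝ} (hA : A.IsSymm) (hB : B.IsSymm) :
    (A * B * A).IsSymm := by
  rw [Matrix.IsSymm, Matrix.transpose_mul, Matrix.transpose_mul, hA, hB, Matrix.mul_assoc]

/-- The Riemannian exponential of the affine-invariant metric,
`exp_P(V) = P^{1/2} exp(P^{-1/2} V P^{-1/2}) P^{1/2}`. -/
def riemExp {n : ℕ} (P V : SymMat n) : SymMat n :=
  ⟨matSqrt P.1 * NormedSpace.exp ((matSqrt P.1)⁻¹ * V.1 * (matSqrt P.1)⁻¹) * matSqrt P.1,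
    isSymm_conj (matSqrt_isSymm P.1)
      (Matrix.IsSymm.exp (isSymm_conj (matSqrt_inv_isSymm P.1) V.2))⟩

/-- The Riemannian logarithm of the affine-invariant metric,
`log_P(Q) = P^{1/2} log(P^{-1/2} Q P^{-1/2}) P^{1/2}`. -/
def riemLog {n : ℕ} (P Q : SymMat n) : SymMat n :=
  ⟨matSqrt P.1 * matLog ((matSqrt P.1)⁻¹ * Q.1 * (matSqrt P.1)⁻¹) * matSqrt P.1,
    isSymm_conj (matSqrt_isSymm P.1) (matLog_isSymm _)⟩

/-- The Riemannian distance of the affine-invariant metric,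
`d(P,Q) = (Tr(log(P^{-1/2} Q P^{-1/2})^2))^{1/2}`. -/
def riemDist {n : ℕ} (P Q : SymMat n) : ℝ :=
  Real.sqrt (Matrix.trace (matLog ((matSqrt P.1)⁻¹ * Q.1 * (matSqrt P.1)⁻¹) ^ 2))

/-- The (squared) Fréchet map `F(P) = (d(R_1,P)^2, …, d(R_ℓ,P)^2)`. -/
def frechetMap {n l : ℕ} (R : Fin l → SymMat n) (P : SymMat n) : Fin l → ℝ :=
  fun i => riemDist (R i) P ^ 2

/-- The weighted sum of squared distances `σ(Q;λ)^2 = ∑ λ_i d(R_i,Q)^2`. -/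
def weightedVar {n l : ℕ} (R : Fin l → SymMat n) (w : Fin l → ℝ) (Q : SymMat n) : ℝ :=
  ∑ i, w i * riemDist (R i) Q ^ 2

/-- The exponential barycentric subspace `EBS(R_1,…,R_ℓ)`: the points of `SPD(n)` that are critical
points of `σ(·;λ)^2` for some weights `λ` of sum one. -/
def EBS {n l : ℕ} (R : Fin l → SymMat n) : Set (SymMat n) :=
  {P | P ∈ SPD n ∧ ∃ w : Fin l → ℝ, ∑ i, w i = 1 ∧
    HasFDerivAt (weightedVar R w) (0 : SymMat n →L[ℝ] ℝ) P}

/-- `Γ_{R_1,…,R_ℓ}`: the points `P` of `SPD(n)` at which `(log_P R_1, …, log_P R_ℓ)` has rank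
`m = n(n+1)/2 = dim Sym(n)`. -/
def fullRankSet {n l : ℕ} (R : Fin l → SymMat n) : Set (SymMat n) :=
  {P | P ∈ SPD n ∧
    Module.finrank ℝ (Submodule.span ℝ (Set.range fun i => riemLog P (R i))) = n * (n + 1) / 2}

/-- `S_{R_1,…,R_ℓ}`: the complement of `Γ_{R_1,…,R_ℓ}` in `SPD(n)`. -/
def singularSet {n l : ℕ} (R : Fin l → SymMat n) : Set (SymMat n) :=
  SPD n \ fullRankSet R

/-- `f` is an immersion on the open set `U`: it is smooth there, with injective differential at every
point. -/
def IsImmersionOnOpen {E F : Type*} [NormedAddCommGroup E] [NormedSpace ℝ E]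
    [NormedAddCommGroup F] [NormedSpace ℝ F] (f : E → F) (U : Set E) : Prop :=
  IsOpen U ∧ ContDiffOn ℝ ∞ f U ∧ ∀ x ∈ U, Function.Injective (fderiv ℝ f x)

/-- The points `R_1,…,R_ℓ` lie on `exp_P(H)` for some `P ∈ SPD_r(n)` and some affine subspace `H` of
`Sym(n)` with `dim H ≤ k - 2`. -/
def LieOnExpOfAffine {n l : ℕ} (r : ℝ) (k : ℕ) (R : Fin l → SymMat n) : Prop :=
  ∃ P ∈ SPDLevel n r, ∃ H : AffineSubspace ℝ (SymMat n),
    Module.finrank ℝ H.direction + 2 ≤ k ∧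
      ∀ i, R i ∈ riemExp P '' (H : Set (SymMat n))

end

/-!
The affine-invariant squared distance `Q ↦ d(R, Q)²` is smooth on `SPD(n)` with gradient
`-2 log_Q R` (`fderiv_riemDist_sq`), and `tr (P⁻¹ log_P R) = log (det R / det P)`
(`trace_inv_mul_riemLog`). Everything else is linear algebra on these two facts.

If all `R i` have determinant `r`, the vectors `log_P (R i)` lie on the affine hyperplane
`tr (P⁻¹ V) = log (r / det P)` of `Sym(n)`. For `det P = r` it passes through the origin, so their
rank is less than `m = dim Sym(n)`. Pairing a vanishing weighted sum of gradients with `P` itself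
forces `log (r / det P) = 0`, so a barycentric point lies on the hypersurface.

For the equalities, let `det P = r` and suppose that the affine span of the `log_P (R i)` has
dimension `m - 1`. It then fills the hyperplane, contains `0`, and so provides weights of sum one
which make `P` critical. If instead `P` is singular with `det P ≠ r`, the hyperplane misses the
origin, so the affine span of the `log_P (R i)` has smaller dimension than their linear span, hence
at most `m - 2`. Since `log_{tP} R = t (log_P R - (log t) P)` (`riemLog_smul`), moving `P` along its
ray to the hypersurface preserves this dimension. Finally, at points where the logarithms span
`Sym(n)`, the differential of the Fréchet map is injective.

The calculus needs the derivative of the matrix logarithm, obtained by inverting the exponential. A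
direction `H` annihilated by `d exp_A` commutes with `exp A` (differentiate `A exp A = exp A A`),
hence with the symmetric matrix `A`, and then `d exp_A H = exp A * H` forces `H = 0`. So `exp` is a
local diffeomorphism of `Sym(n)`, its image `SPD(n)` is open and the logarithm is smooth
(`contDiffAt_symLog`). The gradient of `tr ((log M)²)` follows from
`tr (B d exp_A H) = tr (B exp A H)` for `B` commuting with `A` (`traceFunctional_mul_fderiv_exp`).
-/

/-! ### The derivative of the exponential in a Banach algebra -/

section BanachAlgebra

variable {𝔸 : Type*} [NormedRing 𝔸] [NormedAlgebra ℝ 𝔸] [CompleteSpace 𝔸]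

theorem contDiff_normedSpace_exp : ContDiff ℝ ∞ (NormedSpace.exp : 𝔸 → 𝔸) := by
  rw [contDiff_iff_contDiffAt]
  exact fun x => (NormedSpace.exp_analytic (𝕂 := ℝ) x).contDiffAt

theorem differentiable_normedSpace_exp : Differentiable ℝ (NormedSpace.exp : 𝔸 → 𝔸) :=
  contDiff_normedSpace_exp.differentiable (by simp)

theorem hasDerivAt_exp_add_smul (A H : 𝔸) :
    HasDerivAt (fun t : ℝ => NormedSpace.exp (A + t • H))
      (fderiv ℝ (NormedSpace.exp : 𝔸 → 𝔸) A H) 0 := by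
  have h1 : HasDerivAt (fun t : ℝ => A + t • H) H 0 := by
    simpa using ((hasDerivAt_id (0 : ℝ)).smul_const H).const_add A
  have h2 : HasFDerivAt (NormedSpace.exp : 𝔸 → 𝔸) (fderiv ℝ NormedSpace.exp A)
      (A + (0 : ℝ) • H) := by
    simpa using (differentiable_normedSpace_exp A).hasFDerivAt
  exact h2.comp_hasDerivAt 0 h1

/-- The derivative of `exp` in a direction commuting with the base point. -/
theorem fderiv_exp_of_commute {A H : 𝔸} (hAH : Commute A H) :
    fderiv ℝ (NormedSpace.exp : 𝔸 → 𝔸) A H = NormedSpace.exp A * H := by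
  let _ : NormedAlgebra ℚ 𝔸 := .restrictScalars ℚ ℝ 𝔸
  refine (hasDerivAt_exp_add_smul A H).unique ?_
  have h : (fun t : ℝ => NormedSpace.exp (A + t • H)) =
      fun t : ℝ => NormedSpace.exp A * NormedSpace.exp (t • H) := by
    ext t
    exact NormedSpace.exp_add_of_commute (hAH.smul_right t)
  rw [h]
  simpa using (hasDerivAt_exp_smul_const' (𝕂 := ℝ) H (0 : ℝ)).const_mul (NormedSpace.exp A)

/-- Differentiating `A * exp A = exp A * A` shows that a direction killed by the derivative of
`exp` at `A` commutes with `exp A`. -/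
theorem commute_exp_of_fderiv_exp_eq_zero {A H : 𝔸}
    (h0 : fderiv ℝ (NormedSpace.exp : 𝔸 → 𝔸) A H = 0) : Commute (NormedSpace.exp A) H := by
  let _ : NormedAlgebra ℚ 𝔸 := .restrictScalars ℚ ℝ 𝔸
  have h1 : HasDerivAt (fun t : ℝ => A + t • H) H 0 := by
    simpa using ((hasDerivAt_id (0 : ℝ)).smul_const H).const_add A
  have h2 := hasDerivAt_exp_add_smul A H
  rw [h0] at h2
  have h3 := h1.mul h2
  have h4 := h2.mul h1
  have h5 : (fun t : ℝ => A + t • H) * (fun t : ℝ => NormedSpace.exp (A + t • H)) =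
      (fun t : ℝ => NormedSpace.exp (A + t • H)) * (fun t : ℝ => A + t • H) := by
    ext t
    exact ((Commute.refl (A + t • H)).exp_right).eq
  rw [h5] at h3
  have := h3.unique h4
  simpa [Commute, SemiconjBy] using this.symm

/-- The hypothesis `hA` holds for every `H` when `A` is a function of `exp A`, as for self-adjoint
`A`. -/
theorem eq_zero_of_fderiv_exp_eq_zero {A H : 𝔸}
    (hA : Commute (NormedSpace.exp A) H → Commute A H)
    (h0 : fderiv ℝ (NormedSpace.exp : 𝔸 → 𝔸) A H = 0) : H = 0 := by
  let _ : NormedAlgebra ℚ 𝔸 := .restrictScalars ℚ ℝ 𝔸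
  have h := fderiv_exp_of_commute (hA (commute_exp_of_fderiv_exp_eq_zero h0))
  rw [h0] at h
  exact ((NormedSpace.isUnit_exp A).mul_right_eq_zero).1 h.symm

/-- The derivative of `exp A = exp (A / 2) * exp (A / 2)`. -/
theorem fderiv_exp_half (A H : 𝔸) :
    fderiv ℝ (NormedSpace.exp : 𝔸 → 𝔸) A H =
      (1 / 2 : ℝ) • (NormedSpace.exp ((1 / 2 : ℝ) • A) *
          fderiv ℝ (NormedSpace.exp : 𝔸 → 𝔸) ((1 / 2 : ℝ) • A) H +
        fderiv ℝ (NormedSpace.exp : 𝔸 → 𝔸) ((1 / 2 : ℝ) • A) H *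
          NormedSpace.exp ((1 / 2 : ℝ) • A)) := by
  let _ : NormedAlgebra ℚ 𝔸 := .restrictScalars ℚ ℝ 𝔸
  refine (hasDerivAt_exp_add_smul A H).unique ?_
  have h1 := hasDerivAt_exp_add_smul ((1 / 2 : ℝ) • A) ((1 / 2 : ℝ) • H)
  have h2 : (fun t : ℝ => NormedSpace.exp (A + t • H)) =
      (fun t : ℝ => NormedSpace.exp ((1 / 2 : ℝ) • A + t • (1 / 2 : ℝ) • H)) *
      (fun t : ℝ => NormedSpace.exp ((1 / 2 : ℝ) • A + t • (1 / 2 : ℝ) • H)) := by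
    ext t
    rw [Pi.mul_apply, ← NormedSpace.exp_add_of_commute (Commute.refl _)]
    congr 1
    module
  rw [h2]
  refine (h1.mul h1).congr_deriv ?_
  simp only [map_smul, zero_smul, add_zero, mul_smul_comm, smul_mul_assoc, smul_add]
  exact add_comm _ _

/-- Under a functional `τ` with the trace property, the derivative of `exp` at `A`, multiplied by
an element commuting with `A`, is the same as if the direction commuted with `A`. The identity
`exp A = exp (A / 2) ^ 2` reduces the claim at `A` to the claim at `A / 2`, and hence to
`A / 2 ^ k`, where the derivative tends to the identity. -/
theorem traceFunctional_mul_fderiv_exp (τ : 𝔸 →L[ℝ] ℝ) (hτ : ∀ x y, τ (x * y) = τ (y * x))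
    {A B : 𝔸} (hAB : Commute A B) (H : 𝔸) :
    τ (B * fderiv ℝ (NormedSpace.exp : 𝔸 → 𝔸) A H) = τ (B * NormedSpace.exp A * H) := by
  let _ : NormedAlgebra ℚ 𝔸 := .restrictScalars ℚ ℝ 𝔸
  have key : ∀ k : ℕ, τ (B * fderiv ℝ (NormedSpace.exp : 𝔸 → 𝔸) A H) =
      τ (B * NormedSpace.exp ((1 - (1 / 2 : ℝ) ^ k) • A) *
        fderiv ℝ (NormedSpace.exp : 𝔸 → 𝔸) (((1 / 2 : ℝ) ^ k) • A) H) := by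
    intro k
    induction k with
    | zero => simp
    | succ k ih =>
      rw [ih, fderiv_exp_half ((1 / 2 : ℝ) ^ k • A), smul_smul, ← pow_succ']
      set D := fderiv ℝ (NormedSpace.exp : 𝔸 → 𝔸) ((1 / 2 : ℝ) ^ (k + 1) • A) H
      set C := B * NormedSpace.exp ((1 - (1 / 2 : ℝ) ^ k) • A)
      set E := NormedSpace.exp ((1 / 2 : ℝ) ^ (k + 1) • A)
      have hBE : Commute B E := ((hAB.symm).smul_right _).exp_right
      have hCE : Commute E C :=
        hBE.symm.mul_right (((Commute.refl A).smul_left _).smul_right _).exp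
      have hC : C * E = B * NormedSpace.exp ((1 - (1 / 2 : ℝ) ^ (k + 1)) • A) := by
        rw [mul_assoc, ← NormedSpace.exp_add_of_commute
          (((Commute.refl A).smul_left _).smul_right _), ← add_smul]
        congr 3
        ring
      rw [← hC, mul_smul_comm, map_smul, mul_add, map_add, ← mul_assoc C D E, hτ (C * D) E,
        ← mul_assoc E, ← mul_assoc C, hCE.eq, smul_eq_mul]
      ring
  have hp : Filter.Tendsto (fun k : ℕ => (1 / 2 : ℝ) ^ k) Filter.atTop (nhds 0) :=
    tendsto_pow_atTop_nhds_zero_of_lt_one (by norm_num) (by norm_num)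
  have hc : Continuous fun s : ℝ => τ (B * NormedSpace.exp ((1 - s) • A) *
      fderiv ℝ (NormedSpace.exp : 𝔸 → 𝔸) (s • A) H) := by
    have h1 : Continuous (fderiv ℝ (NormedSpace.exp : 𝔸 → 𝔸)) :=
      contDiff_normedSpace_exp.continuous_fderiv (by simp)
    have h2 : Continuous (NormedSpace.exp : 𝔸 → 𝔸) := NormedSpace.exp_continuous
    fun_prop
  have hl := (hc.tendsto 0).comp hp
  have h0 : fderiv ℝ (NormedSpace.exp : 𝔸 → 𝔸) 0 = 1 := hasFDerivAt_exp_zero.fderiv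
  simp only [Function.comp_def, ← key, sub_zero, one_smul, zero_smul, h0] at hl
  simpa using tendsto_nhds_unique tendsto_const_nhds hl

end BanachAlgebra

/-! ### Functional calculus of real symmetric matrices -/

section FunctionalCalculus

variable {n : ℕ} {A B : Matrix (Fin n) (Fin n) ℝ}

theorem continuousOn_matrix_spectrum (f : ℝ → ℝ) (A : Matrix (Fin n) (Fin n) ℝ) :
    ContinuousOn f (spectrum ℝ A) :=
  (Matrix.finite_real_spectrum (A := A)).continuousOn f

theorem matrix_exp_eq_cfc (hA : A.IsHermitian) : NormedSpace.exp A = cfc Real.exp A := by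
  rw [hA.cfc_eq, Matrix.IsHermitian.cfc, Unitary.conjStarAlgAut_apply]
  conv_lhs => rw [hA.spectral_theorem, Unitary.conjStarAlgAut_apply]
  have hU : (star (hA.eigenvectorUnitary : Matrix (Fin n) (Fin n) ℝ)) =
      (hA.eigenvectorUnitary : Matrix (Fin n) (Fin n) ℝ)⁻¹ :=
    (Matrix.inv_eq_left_inv (Unitary.coe_star_mul_self hA.eigenvectorUnitary)).symm
  rw [hU, Matrix.exp_conj _ _ (Unitary.isUnit_coe (U := hA.eigenvectorUnitary)), Matrix.exp_diagonal]
  congr 3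
  ext i
  simp [Real.exp_eq_exp_ℝ]

theorem matLog_exp (hA : A.IsHermitian) : matLog (NormedSpace.exp A) = A := by
  rw [matLog, matrix_exp_eq_cfc hA]
  refine (cfc_comp' Real.log Real.exp A ((Matrix.finite_real_spectrum.image _).continuousOn _)
    (continuousOn_matrix_spectrum _ _) hA).symm.trans ?_
  simpa using cfc_id' ℝ A hA

theorem spectrum_pos_of_posDef (hA : A.PosDef) {x : ℝ} (hx : x ∈ spectrum ℝ A) : 0 < x := by
  rw [hA.isHermitian.spectrum_real_eq_range_eigenvalues] at hx
  obtain ⟨i, rfl⟩ := hx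
  exact hA.eigenvalues_pos i

theorem matLog_isHermitian (A : Matrix (Fin n) (Fin n) ℝ) : (matLog A).IsHermitian :=
  cfc_predicate Real.log A

theorem exp_matLog (hA : A.PosDef) : NormedSpace.exp (matLog A) = A := by
  rw [matrix_exp_eq_cfc (matLog_isHermitian A), matLog]
  refine (cfc_comp' Real.exp Real.log A ((Matrix.finite_real_spectrum.image _).continuousOn _)
    (continuousOn_matrix_spectrum _ _) hA.isHermitian).symm.trans ?_
  exact (cfc_congr fun x hx => Real.exp_log (spectrum_pos_of_posDef hA hx)).trans
    (cfc_id' ℝ A hA.isHermitian)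

theorem exp_posDef (hA : A.IsHermitian) : (NormedSpace.exp A).PosDef := by
  have h : (NormedSpace.exp A) =
      NormedSpace.exp ((1 / 2 : ℝ) • A) * NormedSpace.exp ((1 / 2 : ℝ) • A) := by
    rw [← Matrix.exp_add_of_commute _ _ (Commute.refl _)]
    congr 1
    module
  have h1 : ((1 / 2 : ℝ) • A).IsHermitian := by
    rw [Matrix.IsHermitian, Matrix.conjTranspose_smul, hA.eq]; simp
  have h2 : (NormedSpace.exp ((1 / 2 : ℝ) • A)).IsHermitian := h1.exp
  rw [h]
  nth_rw 1 [← h2.eq]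
  exact Matrix.PosDef.conjTranspose_mul_self _
    (Matrix.mulVec_injective_of_isUnit (Matrix.isUnit_exp _))

theorem matLog_inv (hA : A.PosDef) : matLog A⁻¹ = -matLog A := by
  have h := (matLog_isHermitian A).neg
  rw [← matLog_exp h, Matrix.exp_neg, exp_matLog hA]

theorem trace_matLog (hA : A.PosDef) : (matLog A).trace = Real.log A.det := by
  have h := hA.isHermitian
  rw [matLog, h.cfc_eq, Matrix.IsHermitian.cfc, Unitary.conjStarAlgAut_apply, Matrix.trace_mul_cycle,
    Unitary.coe_star_mul_self, one_mul, Matrix.trace_diagonal, h.det_eq_prod_eigenvalues]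
  simp only [Function.comp_apply, RCLike.ofReal_real_eq_id, id_eq]
  rw [Real.log_prod fun i _ => (hA.eigenvalues_pos i).ne']

theorem matSqrt_mul_self (hA : A.PosDef) : matSqrt A * matSqrt A = A := by
  rw [matSqrt, ← cfc_mul Real.sqrt Real.sqrt A (continuousOn_matrix_spectrum _ _)
    (continuousOn_matrix_spectrum _ _)]
  have h : cfc (fun x => Real.sqrt x * Real.sqrt x) A = cfc (fun x => x) A :=
    cfc_congr fun x hx => Real.mul_self_sqrt (spectrum_pos_of_posDef hA hx).le
  rw [h]
  exact cfc_id' ℝ A hA.isHermitian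

theorem isUnit_matSqrt (hA : A.PosDef) : IsUnit (matSqrt A) :=
  isUnit_of_mul_isUnit_left (y := matSqrt A) (by rw [matSqrt_mul_self hA]; exact hA.isUnit)

/-- Functional calculus intertwines: one Lagrange interpolation polynomial represents `f` on both
spectra, and polynomials intertwine. -/
theorem cfc_mul_of_intertwine (f : ℝ → ℝ) {W : Matrix (Fin n) (Fin n) ℝ}
    (hA : A.IsHermitian) (hB : B.IsHermitian) (h : A * W = W * B) :
    cfc f A * W = W * cfc f B := by
  classical
  set s : Finset ℝ := (Matrix.finite_real_spectrum (A := A)).toFinset ∪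
    (Matrix.finite_real_spectrum (A := B)).toFinset
  set p : Polynomial ℝ := Lagrange.interpolate s id f
  have hp : ∀ x ∈ s, f x = p.eval x := fun x hx =>
    (Lagrange.eval_interpolate_at_node f (Set.injOn_id _) hx).symm
  have hfA : cfc f A = Polynomial.aeval A p := by
    rw [← cfc_polynomial p A hA]
    exact cfc_congr fun x hx => hp x (by simp [s, hx])
  have hfB : cfc f B = Polynomial.aeval B p := by
    rw [← cfc_polynomial p B hB]
    exact cfc_congr fun x hx => hp x (by simp [s, hx])
  rw [hfA, hfB]
  clear hfA hfB hp
  clear_value p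
  induction p using Polynomial.induction_on' with
  | add p q hp hq => rw [map_add, map_add, add_mul, mul_add, hp, hq]
  | monomial k a =>
    rw [Polynomial.aeval_monomial, Polynomial.aeval_monomial, ← Algebra.smul_def,
      ← Algebra.smul_def, smul_mul_assoc, mul_smul_comm]
    congr 1
    exact ((show SemiconjBy W B A from h.symm).pow_right k).eq.symm

theorem commute_matLog (hA : A.IsHermitian) (h : Commute A B) : Commute (matLog A) B :=
  cfc_mul_of_intertwine Real.log hA hA h

end FunctionalCalculus

/-! ### Exponential and logarithm as mutually inverse diffeomorphisms of `Sym(n)` and `SPD(n)` -/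

section Bilinear

variable {E : Type*} [NormedAddCommGroup E] [NormedSpace ℝ E]

theorem contDiffAt_bilinear_self (b : E →L[ℝ] E →L[ℝ] ℝ) {f : E → E} {x : E}
    (hf : ContDiffAt ℝ ∞ f x) : ContDiffAt ℝ ∞ (fun y => b (f y) (f y)) x :=
  b.isBoundedBilinearMap.contDiff.contDiffAt.comp x (hf.prodMk hf)

theorem fderiv_bilinear_self (b : E →L[ℝ] E →L[ℝ] ℝ) {f : E → E} {x : E}
    (hf : DifferentiableAt ℝ f x) (v : E) : fderiv ℝ (fun y => b (f y) (f y)) x v =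
      b (f x) (fderiv ℝ f x v) + b (fderiv ℝ f x v) (f x) := by
  have := (b.hasFDerivAt_of_bilinear hf.hasFDerivAt hf.hasFDerivAt).fderiv
  rw [this]; simp

end Bilinear

section SymExp

variable {n : ℕ}

theorem isHermitian_of_symMat (A : SymMat n) : A.1.IsHermitian :=
  (isSymm_iff_isHermitian_real _).1 A.2

/-- The matrix exponential as a self-map of `Sym(n)`. -/
noncomputable def symExp (A : SymMat n) : SymMat n :=
  ⟨NormedSpace.exp A.1, Matrix.IsSymm.exp A.2⟩

/-- The matrix logarithm as a self-map of `Sym(n)`; meaningful on `SPD(n)`. -/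
noncomputable def symLog (A : SymMat n) : SymMat n :=
  ⟨matLog A.1, matLog_isSymm A.1⟩

theorem symLog_symExp (A : SymMat n) : symLog (symExp A) = A :=
  Subtype.ext (matLog_exp (isHermitian_of_symMat A))

theorem symExp_symLog {P : SymMat n} (hP : P ∈ SPD n) : symExp (symLog P) = P :=
  Subtype.ext (exp_matLog hP)

theorem symExp_mem_SPD (A : SymMat n) : symExp A ∈ SPD n := exp_posDef (isHermitian_of_symMat A)

/-- The algebra isomorphism from matrices onto the endomorphisms of Euclidean space, as a linear map.
The entrywise norm on matrices is not submultiplicative, so the exponential is differentiated in the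
Banach algebra of endomorphisms. -/
noncomputable def matToCLM (n : ℕ) : Matrix (Fin n) (Fin n) ℝ →L[ℝ]
    (EuclideanSpace ℝ (Fin n) →L[ℝ] EuclideanSpace ℝ (Fin n)) :=
  LinearMap.toContinuousLinearMap
    (Matrix.toEuclideanCLM (𝕜 := ℝ) (n := Fin n)).toAlgEquiv.toLinearEquiv.toLinearMap

/-- The inverse of `matToCLM`. -/
noncomputable def clmToMat (n : ℕ) :
    (EuclideanSpace ℝ (Fin n) →L[ℝ] EuclideanSpace ℝ (Fin n)) →L[ℝ] Matrix (Fin n) (Fin n) ℝ :=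
  LinearMap.toContinuousLinearMap
    (Matrix.toEuclideanCLM (𝕜 := ℝ) (n := Fin n)).toAlgEquiv.symm.toLinearEquiv.toLinearMap

theorem matToCLM_apply (A : Matrix (Fin n) (Fin n) ℝ) :
    matToCLM n A = Matrix.toEuclideanCLM (𝕜 := ℝ) A := rfl

theorem clmToMat_apply (A : EuclideanSpace ℝ (Fin n) →L[ℝ] EuclideanSpace ℝ (Fin n)) :
    clmToMat n A = (Matrix.toEuclideanCLM (𝕜 := ℝ) (n := Fin n)).toAlgEquiv.symm A := rfl

theorem clmToMat_matToCLM (A : Matrix (Fin n) (Fin n) ℝ) : clmToMat n (matToCLM n A) = A :=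
  (Matrix.toEuclideanCLM (𝕜 := ℝ) (n := Fin n)).toAlgEquiv.symm_apply_apply A

theorem matToCLM_clmToMat (A : EuclideanSpace ℝ (Fin n) →L[ℝ] EuclideanSpace ℝ (Fin n)) :
    matToCLM n (clmToMat n A) = A :=
  (Matrix.toEuclideanCLM (𝕜 := ℝ) (n := Fin n)).toAlgEquiv.apply_symm_apply A

theorem matToCLM_injective : Function.Injective (matToCLM n) :=
  Function.LeftInverse.injective clmToMat_matToCLM

theorem matToCLM_mul (A B : Matrix (Fin n) (Fin n) ℝ) :
    matToCLM n (A * B) = matToCLM n A * matToCLM n B := by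
  simp only [matToCLM_apply, map_mul]

theorem clmToMat_mul (A B : EuclideanSpace ℝ (Fin n) →L[ℝ] EuclideanSpace ℝ (Fin n)) :
    clmToMat n (A * B) = clmToMat n A * clmToMat n B := by
  simp only [clmToMat_apply, map_mul]

theorem matToCLM_exp (A : Matrix (Fin n) (Fin n) ℝ) :
    matToCLM n (NormedSpace.exp A) = NormedSpace.exp (matToCLM n A) := by
  have h := (NormedSpace.exp_series_hasSum_exp' (𝕂 := ℝ) (matToCLM n A)).map (clmToMat n)
    (clmToMat n).continuous
  have h2 : clmToMat n (NormedSpace.exp (matToCLM n A)) = NormedSpace.exp A := by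
    rw [NormedSpace.exp_eq_tsum ℝ (𝔸 := Matrix (Fin n) (Fin n) ℝ), ← h.tsum_eq]
    refine tsum_congr fun k => ?_
    simp only [Function.comp_apply, map_smul, clmToMat_apply, matToCLM_apply, map_pow]
    congr 2
    exact clmToMat_matToCLM A
  rw [← h2, matToCLM_clmToMat]

/-- The symmetric part of a matrix. -/
noncomputable def symPart (n : ℕ) : Matrix (Fin n) (Fin n) ℝ →L[ℝ] SymMat n :=
  LinearMap.toContinuousLinearMap
    { toFun := fun A => ⟨(1 / 2 : ℝ) • (A + Aᵀ), by
        change ((1 / 2 : ℝ) • (A + Aᵀ))ᵀ = _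
        rw [Matrix.transpose_smul, Matrix.transpose_add, Matrix.transpose_transpose, add_comm]⟩
      map_add' := fun A B => Subtype.ext (by
        simp only [Matrix.transpose_add, Submodule.coe_add]; module)
      map_smul' := fun c A => Subtype.ext (by
        simp only [Matrix.transpose_smul, Submodule.coe_smul, RingHom.id_apply]; module) }

theorem symPart_coe (A : SymMat n) : symPart n A.1 = A := by
  refine Subtype.ext ?_
  change (1 / 2 : ℝ) • (A.1 + A.1ᵀ) = A.1
  rw [show A.1ᵀ = A.1 from A.2]
  module

/-- The embedding of `Sym(n)` into the endomorphisms of Euclidean space. -/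
noncomputable def symToCLM (n : ℕ) :
    SymMat n →L[ℝ] (EuclideanSpace ℝ (Fin n) →L[ℝ] EuclideanSpace ℝ (Fin n)) :=
  (matToCLM n).comp (SymMat n).subtypeL

theorem symToCLM_apply (A : SymMat n) : symToCLM n A = matToCLM n A.1 := rfl

theorem symToCLM_symExp (A : SymMat n) :
    symToCLM n (symExp A) = NormedSpace.exp (symToCLM n A) :=
  matToCLM_exp A.1

theorem symExp_eq (A : SymMat n) :
    symExp A = symPart n (clmToMat n (NormedSpace.exp (symToCLM n A))) := by
  rw [← symToCLM_symExp, symToCLM_apply, clmToMat_matToCLM, symPart_coe]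

theorem contDiff_symExp : ContDiff ℝ ∞ (symExp : SymMat n → SymMat n) := by
  rw [show (symExp : SymMat n → SymMat n) = _ from funext symExp_eq]
  exact (symPart n).contDiff.comp ((clmToMat n).contDiff.comp
    (contDiff_normedSpace_exp.comp (symToCLM n).contDiff))

theorem differentiable_symExp : Differentiable ℝ (symExp : SymMat n → SymMat n) :=
  contDiff_symExp.differentiable (by simp)

theorem symToCLM_fderiv_symExp (A H : SymMat n) :
    symToCLM n (fderiv ℝ symExp A H) =
      fderiv ℝ NormedSpace.exp (symToCLM n A) (symToCLM n H) := by
  have h1 := (symToCLM n).hasFDerivAt.comp A (differentiable_symExp A).hasFDerivAt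
  have h2 := (differentiable_normedSpace_exp (symToCLM n A)).hasFDerivAt.comp A
    (symToCLM n).hasFDerivAt
  rw [show (symToCLM n : SymMat n → _) ∘ symExp = NormedSpace.exp ∘ symToCLM n from
    funext symToCLM_symExp] at h1
  exact DFunLike.congr_fun (h1.unique h2) H

/-- A symmetric matrix `A` is the logarithm of `exp A`, so it commutes with whatever `exp A`
commutes with. -/
theorem fderiv_symExp_injective (A : SymMat n) :
    Function.Injective (fderiv ℝ (symExp : SymMat n → SymMat n) A) := by
  rw [injective_iff_map_eq_zero]
  intro H hH
  have h := symToCLM_fderiv_symExp A H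
  rw [hH, map_zero] at h
  have h0 := eq_zero_of_fderiv_exp_eq_zero (A := symToCLM n A) (H := symToCLM n H) ?_ h.symm
  · exact Subtype.ext (matToCLM_injective (h0.trans (map_zero _).symm))
  · intro hc
    rw [← symToCLM_symExp] at hc
    have h1 : Commute (symExp A).1 H.1 := by
      apply matToCLM_injective
      rw [matToCLM_mul, matToCLM_mul]
      exact hc
    have h2 := commute_matLog (isHermitian_of_symMat (symExp A)) h1
    rw [show matLog (symExp A).1 = A.1 from matLog_exp (isHermitian_of_symMat A)] at h2
    change matToCLM n A.1 * matToCLM n H.1 = matToCLM n H.1 * matToCLM n A.1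
    rw [← matToCLM_mul, ← matToCLM_mul, h2.eq]

/-- The derivative of the exponential at a symmetric matrix as an automorphism of `Sym(n)`. -/
noncomputable def symExpDeriv (A : SymMat n) : SymMat n ≃L[ℝ] SymMat n :=
  (LinearEquiv.ofInjectiveEndo (fderiv ℝ symExp A).toLinearMap
    (fderiv_symExp_injective A)).toContinuousLinearEquiv

theorem hasFDerivAt_symExp (A : SymMat n) :
    HasFDerivAt symExp (symExpDeriv A : SymMat n →L[ℝ] SymMat n) A :=
  (differentiable_symExp A).hasFDerivAt

theorem trace_mul_fderiv_symExp {A : SymMat n} {B : Matrix (Fin n) (Fin n) ℝ}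
    (hAB : Commute A.1 B) (H : SymMat n) :
    (B * (fderiv ℝ symExp A H).1).trace = (B * NormedSpace.exp A.1 * H.1).trace := by
  let τ : (EuclideanSpace ℝ (Fin n) →L[ℝ] EuclideanSpace ℝ (Fin n)) →L[ℝ] ℝ :=
    (LinearMap.toContinuousLinearMap (Matrix.traceLinearMap (Fin n) ℝ ℝ)).comp (clmToMat n)
  have hτ : ∀ x, τ (matToCLM n x) = x.trace := fun x => by
    change (clmToMat n (matToCLM n x)).trace = _
    rw [clmToMat_matToCLM]
  have h := traceFunctional_mul_fderiv_exp τ (fun x y => by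
    change (clmToMat n (x * y)).trace = (clmToMat n (y * x)).trace
    rw [clmToMat_mul, clmToMat_mul, Matrix.trace_mul_comm]) (A := symToCLM n A)
    (B := matToCLM n B) (by
      change matToCLM n A.1 * matToCLM n B = matToCLM n B * matToCLM n A.1
      rw [← matToCLM_mul, ← matToCLM_mul, hAB.eq]) (symToCLM n H)
  rw [← symToCLM_fderiv_symExp, ← symToCLM_symExp, symToCLM_apply, symToCLM_apply, symToCLM_apply,
    ← matToCLM_mul, ← matToCLM_mul, ← matToCLM_mul, hτ, hτ] at h
  exact h

theorem map_nhds_symExp (A : SymMat n) : (nhds A).map symExp = nhds (symExp A) :=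
  (contDiff_symExp.contDiffAt.hasStrictFDerivAt' (hasFDerivAt_symExp A)
    (by simp)).map_nhds_eq_of_equiv

/-- `SPD(n)` is open, being the image of the local homeomorphism `symExp`. -/
theorem isOpen_SPD (n : ℕ) : IsOpen (SPD n) := by
  rw [isOpen_iff_mem_nhds]
  intro P hP
  rw [← symExp_symLog hP, ← map_nhds_symExp]
  exact Filter.mem_map.2 (Filter.univ_mem' symExp_mem_SPD)

/-- The logarithm coincides near a positive definite matrix with the local inverse of the
exponential, so it is smooth. -/
theorem contDiffAt_symLog {P : SymMat n} (hP : P ∈ SPD n) : ContDiffAt ℝ ∞ symLog P := by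
  have h1 : ContDiffAt ℝ ∞ symExp (symLog P) := contDiff_symExp.contDiffAt
  have h2 := h1.to_localInverse (hasFDerivAt_symExp (symLog P)) (by simp)
  rw [symExp_symLog hP] at h2
  refine h2.congr_of_eventuallyEq ?_
  have h3 := (h1.hasStrictFDerivAt' (hasFDerivAt_symExp (symLog P))
    (by simp)).eventually_right_inverse
  rw [symExp_symLog hP] at h3
  filter_upwards [h3] with Y hY
  nth_rw 1 [← hY]
  exact symLog_symExp _

theorem hasFDerivAt_symLog {P : SymMat n} (hP : P ∈ SPD n) :
    HasFDerivAt symLog (fderiv ℝ symLog P) P :=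
  ((contDiffAt_symLog hP).differentiableAt (by simp)).hasFDerivAt

theorem fderiv_symExp_fderiv_symLog {P : SymMat n} (hP : P ∈ SPD n) (X : SymMat n) :
    fderiv ℝ symExp (symLog P) (fderiv ℝ symLog P X) = X := by
  have h1 := (differentiable_symExp (symLog P)).hasFDerivAt.comp P (hasFDerivAt_symLog hP)
  have h2 : HasFDerivAt (symExp ∘ symLog) (ContinuousLinearMap.id ℝ (SymMat n)) P := by
    refine (hasFDerivAt_id P).congr_of_eventuallyEq ?_
    filter_upwards [(isOpen_SPD n).mem_nhds hP] with Y hY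
    exact symExp_symLog hY
  exact DFunLike.congr_fun (h1.unique h2) X

/-- The trace form `(X, Y) ↦ tr (X Y)` on `Sym(n)`. -/
noncomputable def traceForm (n : ℕ) : SymMat n →L[ℝ] SymMat n →L[ℝ] ℝ :=
  LinearMap.toContinuousBilinearMap
    (LinearMap.mk₂ ℝ (fun X Y : SymMat n => (X.1 * Y.1).trace)
      (fun X Y Z => by simp [add_mul]) (fun c X Y => by simp)
      (fun X Y Z => by simp [mul_add]) (fun c X Y => by simp))

/-- The function `M ↦ tr ((log M)²)`, the squared distance to the identity. -/
noncomputable def sqLogTrace (M : SymMat n) : ℝ := traceForm n (symLog M) (symLog M)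

theorem contDiffAt_sqLogTrace {M : SymMat n} (hM : M ∈ SPD n) : ContDiffAt ℝ ∞ sqLogTrace M :=
  contDiffAt_bilinear_self (traceForm n) (contDiffAt_symLog hM)

theorem fderiv_sqLogTrace {M : SymMat n} (hM : M ∈ SPD n) (X : SymMat n) :
    fderiv ℝ sqLogTrace M X = 2 * (matLog M.1 * M.1⁻¹ * X.1).trace := by
  have h1 := hasFDerivAt_symLog hM
  have h3 : fderiv ℝ sqLogTrace M X = _ :=
    fderiv_bilinear_self (traceForm n) h1.differentiableAt X
  rw [h3]
  set Y := fderiv ℝ symLog M X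
  have hd : IsUnit M.1.det := (Matrix.isUnit_iff_isUnit_det _).1 (Matrix.PosDef.isUnit hM)
  have hc : Commute (matLog M.1) M.1 := commute_matLog (isHermitian_of_symMat M) (Commute.refl _)
  have hc' : Commute (matLog M.1) M.1⁻¹ := by
    rw [Commute, SemiconjBy]
    calc matLog M.1 * M.1⁻¹ = M.1⁻¹ * (M.1 * matLog M.1) * M.1⁻¹ := by
          rw [← mul_assoc, Matrix.nonsing_inv_mul _ hd, one_mul]
      _ = M.1⁻¹ * matLog M.1 := by
          rw [← hc.eq, ← mul_assoc, mul_assoc, Matrix.mul_nonsing_inv _ hd, mul_one]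
  -- as `d exp_{log M} Y = X`, this becomes `tr (log M * M⁻¹ * X) = tr (log M * Y)`
  have h4 := trace_mul_fderiv_symExp (A := symLog M) (B := matLog M.1 * M.1⁻¹)
    ((Commute.refl _).mul_right hc') Y
  rw [fderiv_symExp_fderiv_symLog hM, show NormedSpace.exp (symLog M).1 = M.1 from exp_matLog hM,
    mul_assoc _ _ M.1, Matrix.nonsing_inv_mul _ hd, mul_one] at h4
  rw [h4]
  change (matLog M.1 * Y.1).trace + (Y.1 * matLog M.1).trace = _
  rw [Matrix.trace_mul_comm Y.1]
  ring

end SymExp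

/-! ### The gradient of the squared distance -/

section Distance

variable {n : ℕ}

/-- The congruence `V ↦ S V S` by a symmetric matrix `S`, as a linear self-map of `Sym(n)`. -/
noncomputable def symConj {S : Matrix (Fin n) (Fin n) ℝ} (hS : S.IsSymm) :
    SymMat n →L[ℝ] SymMat n :=
  LinearMap.toContinuousLinearMap
    { toFun := fun V => ⟨S * V.1 * S, isSymm_conj hS V.2⟩
      map_add' := fun V W => Subtype.ext (by simp [mul_add, add_mul])
      map_smul' := fun c V => Subtype.ext (by simp) }

theorem symConj_apply_coe {S : Matrix (Fin n) (Fin n) ℝ} (hS : S.IsSymm) (V : SymMat n) :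
    (symConj hS V).1 = S * V.1 * S := rfl

theorem symConj_mem_SPD {S : Matrix (Fin n) (Fin n) ℝ} (hS : S.IsSymm) (hu : IsUnit S)
    {P : SymMat n} (hP : P ∈ SPD n) : symConj hS P ∈ SPD n := by
  change (S * P.1 * S).PosDef
  have h := Matrix.PosDef.conjTranspose_mul_mul_same (B := S) hP
    (Matrix.mulVec_injective_of_isUnit hu)
  rwa [((isSymm_iff_isHermitian_real S).1 hS).eq] at h

theorem isUnit_matSqrt_inv {A : Matrix (Fin n) (Fin n) ℝ} (hA : A.PosDef) :
    IsUnit (matSqrt A)⁻¹ :=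
  Matrix.isUnit_nonsing_inv_iff.2 (isUnit_matSqrt hA)

theorem posDef_normalized {R P : SymMat n} (hR : R ∈ SPD n) (hP : P ∈ SPD n) :
    ((matSqrt R.1)⁻¹ * P.1 * (matSqrt R.1)⁻¹).PosDef :=
  symConj_mem_SPD (matSqrt_inv_isSymm R.1) (isUnit_matSqrt_inv hR) hP

theorem trace_mul_self_nonneg {A : Matrix (Fin n) (Fin n) ℝ} (hA : A.IsHermitian) :
    0 ≤ (A * A).trace := by
  have h := (Matrix.posSemidef_conjTranspose_mul_self A).trace_nonneg
  rwa [hA.eq] at h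

theorem riemDist_sq (R P : SymMat n) :
    riemDist R P ^ 2 = sqLogTrace (symConj (matSqrt_inv_isSymm R.1) P) := by
  rw [riemDist, pow_two (matLog _), Real.sq_sqrt (trace_mul_self_nonneg (matLog_isHermitian _))]
  rfl

theorem contDiffAt_riemDist_sq {R P : SymMat n} (hR : R ∈ SPD n) (hP : P ∈ SPD n) :
    ContDiffAt ℝ ∞ (fun Q => riemDist R Q ^ 2) P := by
  rw [show (fun Q => riemDist R Q ^ 2) = _ from funext fun Q => riemDist_sq R Q]
  exact (contDiffAt_sqLogTrace (posDef_normalized hR hP)).comp P (symConj _).contDiff.contDiffAt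

/-- With `M = R^{-1/2} P R^{-1/2}` and `N = P^{-1/2} R P^{-1/2}`, the matrix `W = P^{-1/2} R^{1/2}`
intertwines `N` and `M⁻¹`, so that it intertwines `log N` and `-log M`. -/
theorem matLog_normalized_swap {R P : SymMat n} (hR : R ∈ SPD n) (hP : P ∈ SPD n) :
    (matSqrt R.1)⁻¹ * (matLog ((matSqrt R.1)⁻¹ * P.1 * (matSqrt R.1)⁻¹) *
        ((matSqrt R.1)⁻¹ * P.1 * (matSqrt R.1)⁻¹)⁻¹) * (matSqrt R.1)⁻¹ =
      -(P.1⁻¹ * (riemLog P R).1 * P.1⁻¹) := by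
  have hM := posDef_normalized hR hP
  have hN := posDef_normalized hP hR
  change _ = -(P.1⁻¹ * (matSqrt P.1 * matLog ((matSqrt P.1)⁻¹ * R.1 * (matSqrt P.1)⁻¹) *
    matSqrt P.1) * P.1⁻¹)
  have hs := (Matrix.isUnit_iff_isUnit_det _).1 (isUnit_matSqrt hR)
  have ht := (Matrix.isUnit_iff_isUnit_det _).1 (isUnit_matSqrt hP)
  have hss : matSqrt R.1 * matSqrt R.1 = R.1 := matSqrt_mul_self hR
  have htt : matSqrt P.1 * matSqrt P.1 = P.1 := matSqrt_mul_self hP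
  set s := matSqrt R.1
  set t := matSqrt P.1
  set M := s⁻¹ * P.1 * s⁻¹ with hMdef
  set N := t⁻¹ * R.1 * t⁻¹ with hNdef
  have hPinv : P.1⁻¹ = t⁻¹ * t⁻¹ := by rw [← htt, Matrix.mul_inv_rev]
  have hMinv : M⁻¹ = s * P.1⁻¹ * s := by
    rw [hMdef, Matrix.mul_inv_rev, Matrix.mul_inv_rev, Matrix.nonsing_inv_nonsing_inv _ hs,
      mul_assoc]
  have hW : N * (t⁻¹ * s) = t⁻¹ * s * M⁻¹ := by
    rw [hMinv, hNdef, hPinv, ← hss]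
    simp only [mul_assoc]
  have h1 : matLog N * (t⁻¹ * s) = t⁻¹ * s * matLog M⁻¹ :=
    cfc_mul_of_intertwine Real.log hN.isHermitian hM.inv.isHermitian hW
  rw [matLog_inv hM] at h1
  have h2 : matLog N * t⁻¹ = -(t⁻¹ * s * matLog M * s⁻¹) := by
    calc matLog N * t⁻¹ = matLog N * (t⁻¹ * s) * s⁻¹ := by
          rw [mul_assoc, mul_assoc, Matrix.mul_nonsing_inv _ hs, mul_one]
      _ = _ := by rw [h1, mul_neg, neg_mul]
  have hc : matLog M * M⁻¹ = M⁻¹ * matLog M := by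
    have h := commute_matLog hM.inv.isHermitian (Commute.refl M⁻¹)
    rw [matLog_inv hM] at h
    exact (Commute.neg_left_iff.1 h).eq
  have hL : s⁻¹ * (matLog M * M⁻¹) * s⁻¹ = P.1⁻¹ * s * matLog M * s⁻¹ := by
    rw [hc, hMinv]
    simp only [← mul_assoc]
    rw [Matrix.nonsing_inv_mul _ hs, one_mul]
  have hR' : P.1⁻¹ * (t * matLog N * t) * P.1⁻¹ = t⁻¹ * (matLog N * t⁻¹) := by
    rw [hPinv]
    calc t⁻¹ * t⁻¹ * (t * matLog N * t) * (t⁻¹ * t⁻¹)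
        = t⁻¹ * (t⁻¹ * t) * matLog N * (t * t⁻¹) * t⁻¹ := by simp only [mul_assoc]
      _ = _ := by
          rw [Matrix.nonsing_inv_mul _ ht, Matrix.mul_nonsing_inv _ ht, mul_one, mul_one, mul_assoc]
  rw [hL, hR', h2, hPinv]
  simp only [mul_neg, neg_neg, mul_assoc]

/-- The gradient at `P` of the squared distance to `R` is `-2 log_P R`. -/
theorem fderiv_riemDist_sq {R P : SymMat n} (hR : R ∈ SPD n) (hP : P ∈ SPD n) (V : SymMat n) :
    fderiv ℝ (fun Q => riemDist R Q ^ 2) P V =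
      -2 * (P.1⁻¹ * (riemLog P R).1 * P.1⁻¹ * V.1).trace := by
  rw [show (fun Q => riemDist R Q ^ 2) = _ from funext fun Q => riemDist_sq R Q]
  have hM : symConj (matSqrt_inv_isSymm R.1) P ∈ SPD n := posDef_normalized hR hP
  have h := ((contDiffAt_sqLogTrace hM).differentiableAt (by simp)).hasFDerivAt.comp P
    (symConj (matSqrt_inv_isSymm R.1)).hasFDerivAt
  have h1 : fderiv ℝ (fun Q => sqLogTrace (symConj (matSqrt_inv_isSymm R.1) Q)) P V =
      fderiv ℝ sqLogTrace (symConj (matSqrt_inv_isSymm R.1) P)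
        (symConj (matSqrt_inv_isSymm R.1) V) := DFunLike.congr_fun h.fderiv V
  rw [h1, fderiv_sqLogTrace hM]
  have h2 := matLog_normalized_swap hR hP
  rw [← neg_eq_iff_eq_neg] at h2
  rw [← h2, symConj_apply_coe, symConj_apply_coe, ← mul_assoc, Matrix.trace_mul_comm, neg_mul,
    neg_mul, Matrix.trace_neg, mul_neg, neg_neg]
  simp only [mul_assoc]

theorem trace_inv_mul_riemLog {R P : SymMat n} (hR : R ∈ SPD n) (hP : P ∈ SPD n) :
    (P.1⁻¹ * (riemLog P R).1).trace = Real.log R.1.det - Real.log P.1.det := by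
  have hN := posDef_normalized hP hR
  have ht := (Matrix.isUnit_iff_isUnit_det _).1 (isUnit_matSqrt hP)
  have htt : matSqrt P.1 * matSqrt P.1 = P.1 := matSqrt_mul_self hP
  have hPinv : P.1⁻¹ = (matSqrt P.1)⁻¹ * (matSqrt P.1)⁻¹ := by
    conv_lhs => rw [← htt, Matrix.mul_inv_rev]
  have hRd : 0 < R.1.det := Matrix.PosDef.det_pos hR
  have hPd : 0 < P.1.det := Matrix.PosDef.det_pos hP
  change (P.1⁻¹ * (matSqrt P.1 * matLog ((matSqrt P.1)⁻¹ * R.1 * (matSqrt P.1)⁻¹) *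
    matSqrt P.1)).trace = _
  rw [Matrix.trace_mul_comm, hPinv]
  rw [show matSqrt P.1 * matLog ((matSqrt P.1)⁻¹ * R.1 * (matSqrt P.1)⁻¹) * matSqrt P.1 *
      ((matSqrt P.1)⁻¹ * (matSqrt P.1)⁻¹) =
      matSqrt P.1 * matLog ((matSqrt P.1)⁻¹ * R.1 * (matSqrt P.1)⁻¹) *
      (matSqrt P.1 * (matSqrt P.1)⁻¹) * (matSqrt P.1)⁻¹ by simp only [mul_assoc]]
  rw [Matrix.mul_nonsing_inv _ ht, mul_one, Matrix.trace_mul_comm, ← mul_assoc,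
    Matrix.nonsing_inv_mul _ ht, one_mul, trace_matLog hN, Matrix.det_mul, Matrix.det_mul,
    mul_right_comm, ← Matrix.det_mul, ← hPinv, Matrix.det_nonsing_inv, Ring.inverse_eq_inv',
    Real.log_mul (inv_ne_zero hPd.ne') hRd.ne', Real.log_inv]
  ring

theorem riemExp_riemLog {R P : SymMat n} (hR : R ∈ SPD n) (hP : P ∈ SPD n) :
    riemExp P (riemLog P R) = R := by
  have hN := posDef_normalized hP hR
  have ht := (Matrix.isUnit_iff_isUnit_det _).1 (isUnit_matSqrt hP)
  refine Subtype.ext ?_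
  change matSqrt P.1 * NormedSpace.exp ((matSqrt P.1)⁻¹ * (matSqrt P.1 *
    matLog ((matSqrt P.1)⁻¹ * R.1 * (matSqrt P.1)⁻¹) * matSqrt P.1) * (matSqrt P.1)⁻¹) *
    matSqrt P.1 = R.1
  have cancel : ∀ {s t X : Matrix (Fin n) (Fin n) ℝ}, s * t = 1 → t * s = 1 →
      s * (t * X * t) * s = X := fun {s t X} h1 h2 => by
    rw [mul_assoc t, ← mul_assoc s, h1, one_mul, mul_assoc, h2, mul_one]
  rw [cancel (Matrix.nonsing_inv_mul _ ht) (Matrix.mul_nonsing_inv _ ht), exp_matLog hN,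
    cancel (Matrix.mul_nonsing_inv _ ht) (Matrix.nonsing_inv_mul _ ht)]

theorem smul_mem_SPD {t : ℝ} (ht : 0 < t) {P : SymMat n} (hP : P ∈ SPD n) : t • P ∈ SPD n :=
  Matrix.PosDef.smul hP ht

theorem matSqrt_smul {t : ℝ} (ht : 0 ≤ t) {A : Matrix (Fin n) (Fin n) ℝ} (hA : A.PosDef) :
    matSqrt (t • A) = Real.sqrt t • matSqrt A := by
  rw [matSqrt, matSqrt]
  refine (cfc_comp_smul t Real.sqrt A ((Matrix.finite_real_spectrum.image _).continuousOn _)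
    hA.isHermitian).symm.trans ?_
  refine Eq.trans ?_ (cfc_smul (Real.sqrt t) Real.sqrt A (continuousOn_matrix_spectrum _ _))
  exact cfc_congr fun x _ => by simp [Real.sqrt_mul ht]

theorem matLog_smul {t : ℝ} (ht : 0 < t) {A : Matrix (Fin n) (Fin n) ℝ} (hA : A.PosDef) :
    matLog (t • A) = Real.log t • (1 : Matrix (Fin n) (Fin n) ℝ) + matLog A := by
  rw [matLog, matLog]
  refine (cfc_comp_smul t Real.log A ((Matrix.finite_real_spectrum.image _).continuousOn _)
    hA.isHermitian).symm.trans ?_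
  rw [← Algebra.algebraMap_eq_smul_one]
  refine Eq.trans ?_ (cfc_const_add (Real.log t) Real.log A (continuousOn_matrix_spectrum _ _)
    hA.isHermitian)
  exact cfc_congr fun x hx => Real.log_mul ht.ne' (spectrum_pos_of_posDef hA hx).ne'

/-- Moving the base point along its ray changes the logarithm by a homothety and a translation. -/
theorem riemLog_smul {t : ℝ} (ht : 0 < t) {R P : SymMat n} (hR : R ∈ SPD n) (hP : P ∈ SPD n) :
    riemLog (t • P) R = t • (riemLog P R - Real.log t • P) := by
  have hN := posDef_normalized hP hR
  have hst : Real.sqrt t ≠ 0 := (Real.sqrt_pos.2 ht).ne'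
  have htt : matSqrt P.1 * matSqrt P.1 = P.1 := matSqrt_mul_self hP
  refine Subtype.ext ?_
  change matSqrt (t • P.1) * matLog ((matSqrt (t • P.1))⁻¹ * R.1 * (matSqrt (t • P.1))⁻¹) *
    matSqrt (t • P.1) = t • (matSqrt P.1 * matLog ((matSqrt P.1)⁻¹ * R.1 * (matSqrt P.1)⁻¹) *
    matSqrt P.1 - Real.log t • P.1)
  have hinv : (Real.sqrt t • matSqrt P.1)⁻¹ = (Real.sqrt t)⁻¹ • (matSqrt P.1)⁻¹ := by
    have := Matrix.inv_smul' (Units.mk0 _ hst) (A := matSqrt P.1)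
      ((Matrix.isUnit_iff_isUnit_det _).1 (isUnit_matSqrt hP))
    simpa [Units.smul_def] using this
  have hti : (Real.sqrt t)⁻¹ * (Real.sqrt t)⁻¹ = t⁻¹ := by
    rw [← mul_inv, Real.mul_self_sqrt ht.le]
  rw [matSqrt_smul ht.le hP, hinv]
  simp only [smul_mul_assoc, mul_smul_comm, smul_smul, hti, Real.mul_self_sqrt ht.le]
  rw [matLog_smul (inv_pos.2 ht) hN, mul_add, add_mul, mul_smul_comm, mul_one, smul_mul_assoc, htt,
    Real.log_inv]
  congr 1
  module

end Distance

/-! ### Families of vectors on an affine hyperplane -/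

section Hyperplane

variable {E : Type*} [AddCommGroup E] [Module ℝ E]
  {ι : Type*} {v : ι → E} {φ : E →ₗ[ℝ] ℝ} {c : ℝ}

theorem vectorSpan_range_le_ker (hv : ∀ i, φ (v i) = c) :
    vectorSpan ℝ (Set.range v) ≤ LinearMap.ker φ := by
  rw [vectorSpan_def, Submodule.span_le]
  rintro _ ⟨_, ⟨i, rfl⟩, _, ⟨j, rfl⟩, rfl⟩
  simp [hv]

variable [FiniteDimensional ℝ E]

theorem finrank_ker_lt (hφ : φ ≠ 0) :
    Module.finrank ℝ (LinearMap.ker φ) < Module.finrank ℝ E :=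
  Submodule.finrank_lt fun h => hφ (LinearMap.ker_eq_top.1 h)

theorem finrank_span_range_lt_of_hyperplane (hφ : φ ≠ 0) (hv : ∀ i, φ (v i) = 0) :
    Module.finrank ℝ (Submodule.span ℝ (Set.range v)) < Module.finrank ℝ E := by
  refine (Submodule.finrank_mono ?_).trans_lt (finrank_ker_lt hφ)
  rw [Submodule.span_le]
  rintro _ ⟨i, rfl⟩
  exact hv i

/-- Vectors on a linear hyperplane whose affine span is at least as large as the hyperplane have `0`
as an affine combination. -/
theorem exists_affine_weights_of_hyperplane [Fintype ι] [Nonempty ι] (hφ : φ ≠ 0)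
    (hv : ∀ i, φ (v i) = 0)
    (h : Module.finrank ℝ E < Module.finrank ℝ (affineSpan ℝ (Set.range v)).direction + 2) :
    ∃ w : ι → ℝ, ∑ i, w i = 1 ∧ ∑ i, w i • v i = 0 := by
  classical
  obtain ⟨i₀⟩ := ‹Nonempty ι›
  rw [direction_affineSpan] at h
  -- the affine span fills the hyperplane, hence contains the origin
  have hk := finrank_ker_lt hφ
  have heq : vectorSpan ℝ (Set.range v) = LinearMap.ker φ :=
    Submodule.eq_of_le_of_finrank_le (vectorSpan_range_le_ker hv) (by omega)
  have h0 : (0 : E) ∈ affineSpan ℝ (Set.range v) := by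
    have h1 : -v i₀ ∈ (affineSpan ℝ (Set.range v)).direction := by
      rw [direction_affineSpan, heq, LinearMap.mem_ker, map_neg, hv, neg_zero]
    simpa using AffineSubspace.vadd_mem_of_mem_direction h1
      (mem_affineSpan ℝ (Set.mem_range_self i₀))
  obtain ⟨w, hw, h2⟩ := eq_affineCombination_of_mem_affineSpan_of_fintype h0
  refine ⟨w, hw, ?_⟩
  rw [Finset.affineCombination_eq_linear_combination _ _ _ hw] at h2
  exact h2.symm

/-- On a hyperplane that misses the origin, the affine span has smaller dimension than the linear
span. -/
theorem finrank_direction_of_hyperplane [Nonempty ι] (hc : c ≠ 0) (hv : ∀ i, φ (v i) = c)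
    (h : Module.finrank ℝ (Submodule.span ℝ (Set.range v)) < Module.finrank ℝ E) :
    Module.finrank ℝ (affineSpan ℝ (Set.range v)).direction + 2 ≤ Module.finrank ℝ E := by
  obtain ⟨i₀⟩ := ‹Nonempty ι›
  rw [direction_affineSpan]
  have hle : vectorSpan ℝ (Set.range v) ≤ Submodule.span ℝ (Set.range v) := by
    rw [vectorSpan_def, Submodule.span_le]
    rintro _ ⟨_, hx, _, hy, rfl⟩
    exact Submodule.sub_mem _ (Submodule.subset_span hx) (Submodule.subset_span hy)
  have hlt : vectorSpan ℝ (Set.range v) < Submodule.span ℝ (Set.range v) := by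
    refine lt_of_le_of_ne hle fun he => hc ?_
    have h1 : v i₀ ∈ vectorSpan ℝ (Set.range v) :=
      he ▸ Submodule.subset_span (Set.mem_range_self i₀)
    rw [← hv i₀]
    exact vectorSpan_range_le_ker hv h1
  have := Submodule.finrank_lt_finrank_of_lt hlt
  omega

end Hyperplane

/-! ### Barycentric subspaces and the singular set -/

section Barycentric

variable {n : ℕ}

/-- A symmetric matrix is a function on unordered pairs of indices. -/
noncomputable def symMatEquivSym2 (n : ℕ) : SymMat n ≃ₗ[ℝ] (Sym2 (Fin n) → ℝ) where
  toFun A := fun p =>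
    Sym2.lift ⟨fun i j => A.1 i j, fun i j => (Matrix.IsSymm.apply A.2 i j).symm⟩ p
  map_add' A B := by
    ext p
    induction p with | _ i j => rfl
  map_smul' c A := by
    ext p
    induction p with | _ i j => rfl
  invFun f := ⟨fun i j => f s(i, j), by
    ext i j
    change f s(j, i) = f s(i, j)
    rw [Sym2.eq_swap]⟩
  left_inv A := rfl
  right_inv f := by
    ext p
    induction p with | _ i j => rfl

theorem finrank_symMat (n : ℕ) : Module.finrank ℝ (SymMat n) = n * (n + 1) / 2 := by
  rw [(symMatEquivSym2 n).finrank_eq, Module.finrank_fintype_fun_eq_card, Sym2.card,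
    Fintype.card_fin, Nat.choose_two_right, Nat.add_sub_cancel, mul_comm]

/-- The linear form `V ↦ tr (P⁻¹ V)`, the differential of `log det` at `P`. -/
noncomputable def traceInv (P : SymMat n) : SymMat n →ₗ[ℝ] ℝ where
  toFun V := (P.1⁻¹ * V.1).trace
  map_add' V W := by simp [mul_add]
  map_smul' c V := by simp

theorem traceInv_self {P : SymMat n} (hP : P ∈ SPD n) : traceInv P P = n := by
  change (P.1⁻¹ * P.1).trace = n
  rw [Matrix.nonsing_inv_mul _ ((Matrix.isUnit_iff_isUnit_det _).1 (Matrix.PosDef.isUnit hP))]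
  simp

theorem traceInv_ne_zero (hn : 1 ≤ n) {P : SymMat n} (hP : P ∈ SPD n) : traceInv P ≠ 0 := by
  intro h
  have h1 := traceInv_self hP
  rw [h, LinearMap.zero_apply] at h1
  exact absurd h1 (by positivity)

theorem traceInv_riemLog {r : ℝ} {R P : SymMat n} (hR : R ∈ SPDLevel n r) (hP : P ∈ SPD n) :
    traceInv P (riemLog P R) = Real.log r - Real.log P.1.det := by
  rw [← hR.2]
  exact trace_inv_mul_riemLog hR.1 hP

/-- The derivative of the squared distance as a bilinear expression, linear in the logarithm. -/
noncomputable def gradForm (P : SymMat n) : SymMat n →ₗ[ℝ] SymMat n →ₗ[ℝ] ℝ :=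
  LinearMap.mk₂ ℝ (fun X V : SymMat n => -2 * (P.1⁻¹ * X.1 * P.1⁻¹ * V.1).trace)
    (fun X Y Z => by simp [add_mul, mul_add]) (fun c X Y => by simp; ring)
    (fun X Y Z => by simp [mul_add]) (fun c X Y => by simp; ring)

theorem fderiv_riemDist_sq_eq_gradForm {R P : SymMat n} (hR : R ∈ SPD n) (hP : P ∈ SPD n)
    (V : SymMat n) : fderiv ℝ (fun Q => riemDist R Q ^ 2) P V = gradForm P (riemLog P R) V :=
  fderiv_riemDist_sq hR hP V

theorem gradForm_self {P : SymMat n} (hP : P ∈ SPD n) (X : SymMat n) :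
    gradForm P X P = -2 * traceInv P X := by
  change -2 * (P.1⁻¹ * X.1 * P.1⁻¹ * P.1).trace = -2 * (P.1⁻¹ * X.1).trace
  rw [mul_assoc _ P.1⁻¹,
    Matrix.nonsing_inv_mul _ ((Matrix.isUnit_iff_isUnit_det _).1 (Matrix.PosDef.isUnit hP)), mul_one]

/-- The form `gradForm P` is nondegenerate: testing against `X = P V P` gives `-2` times `tr (V²)`. -/
theorem eq_zero_of_gradForm_eq_zero {P V : SymMat n} (hP : P ∈ SPD n)
    (h : ∀ X, gradForm P X V = 0) : V = 0 := by
  have h1 : -2 * (P.1⁻¹ * (P.1 * V.1 * P.1) * P.1⁻¹ * V.1).trace = 0 :=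
    h ⟨P.1 * V.1 * P.1, isSymm_conj P.2 V.2⟩
  have hd := (Matrix.isUnit_iff_isUnit_det _).1 (Matrix.PosDef.isUnit hP)
  rw [show P.1⁻¹ * (P.1 * V.1 * P.1) * P.1⁻¹ * V.1 = P.1⁻¹ * P.1 * V.1 * (P.1 * P.1⁻¹) * V.1 by
    simp only [mul_assoc], Matrix.nonsing_inv_mul _ hd, Matrix.mul_nonsing_inv _ hd, one_mul,
    mul_one] at h1
  have h2 : (V.1ᴴ * V.1).trace = 0 := by
    rw [(isHermitian_of_symMat V).eq]
    linarith
  exact Subtype.ext (Matrix.trace_conjTranspose_mul_self_eq_zero_iff.1 h2)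

theorem hasFDerivAt_riemDist_sq {R P : SymMat n} (hR : R ∈ SPD n) (hP : P ∈ SPD n) :
    HasFDerivAt (fun Q => riemDist R Q ^ 2) (fderiv ℝ (fun Q => riemDist R Q ^ 2) P) P :=
  ((contDiffAt_riemDist_sq hR hP).differentiableAt (by simp)).hasFDerivAt

theorem hasFDerivAt_weightedVar {l : ℕ} {R : Fin l → SymMat n} (hR : ∀ i, R i ∈ SPD n)
    (w : Fin l → ℝ) {P : SymMat n} (hP : P ∈ SPD n) :
    HasFDerivAt (weightedVar R w)
      (∑ i, w i • fderiv ℝ (fun Q => riemDist (R i) Q ^ 2) P) P :=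
  HasFDerivAt.fun_sum fun i _ => (hasFDerivAt_riemDist_sq (hR i) hP).const_mul (w i)

/-- The derivative of the weighted sum of squared distances vanishes exactly where the weighted
sum of the logarithms, tested by `gradForm`, does. -/
theorem hasFDerivAt_weightedVar_zero_iff {l : ℕ} {R : Fin l → SymMat n} (hR : ∀ i, R i ∈ SPD n)
    (w : Fin l → ℝ) {P : SymMat n} (hP : P ∈ SPD n) :
    HasFDerivAt (weightedVar R w) (0 : SymMat n →L[ℝ] ℝ) P ↔
      ∀ V, gradForm P (∑ i, w i • riemLog P (R i)) V = 0 := by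
  have h := hasFDerivAt_weightedVar hR w hP
  have hV : ∀ V, (∑ i, w i • fderiv ℝ (fun Q => riemDist (R i) Q ^ 2) P) V =
      gradForm P (∑ i, w i • riemLog P (R i)) V := fun V => by
    simp [fderiv_riemDist_sq_eq_gradForm (hR _) hP]
  constructor
  · intro h0 V
    rw [← hV, h.unique h0, zero_apply]
  · intro h0
    convert h
    ext V
    rw [hV, h0, zero_apply]

theorem EBS_subset_SPDLevel {l : ℕ} {r : ℝ} (hr : 0 < r) {R : Fin l → SymMat n}
    (hR : ∀ i, R i ∈ SPDLevel n r) : EBS R ⊆ SPDLevel n r := by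
  rintro P ⟨hP, w, hw, h⟩
  refine ⟨hP, ?_⟩
  have h1 := (hasFDerivAt_weightedVar_zero_iff (fun i => (hR i).1) w hP).1 h P
  rw [gradForm_self hP, map_sum] at h1
  simp only [map_smul, traceInv_riemLog (hR _) hP, smul_eq_mul] at h1
  rw [← Finset.sum_mul, hw] at h1
  exact Real.log_injOn_pos (Matrix.PosDef.det_pos hP) hr (by linarith)

theorem SPDLevel_subset_singularSet {l : ℕ} (hn : 1 ≤ n) {r : ℝ} {R : Fin l → SymMat n}
    (hR : ∀ i, R i ∈ SPDLevel n r) : SPDLevel n r ⊆ singularSet R := by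
  rintro P ⟨hP, hd⟩
  refine ⟨hP, fun h => ?_⟩
  have h1 := finrank_span_range_lt_of_hyperplane (v := fun i => riemLog P (R i))
    (traceInv_ne_zero hn hP) fun i => by rw [traceInv_riemLog (hR i) hP, hd, sub_self]
  rw [h.2, finrank_symMat] at h1
  exact h1.false

theorem SPDLevel_subset_EBS (hn : 1 ≤ n) {l : ℕ} [Nonempty (Fin l)] {r : ℝ}
    {R : Fin l → SymMat n} (hR : ∀ i, R i ∈ SPDLevel n r)
    (hgen : ¬ LieOnExpOfAffine r (n * (n + 1) / 2) R) : SPDLevel n r ⊆ EBS R := by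
  rintro P ⟨hP, hd⟩
  refine ⟨hP, ?_⟩
  obtain ⟨w, hw, h⟩ := exists_affine_weights_of_hyperplane (v := fun i => riemLog P (R i))
    (traceInv_ne_zero hn hP) (fun i => by rw [traceInv_riemLog (hR i) hP, hd, sub_self]) (by
      rw [finrank_symMat]
      by_contra! hlt
      exact hgen ⟨P, ⟨hP, hd⟩, _, hlt, fun i => ⟨riemLog P (R i),
        mem_affineSpan ℝ (Set.mem_range_self i), riemExp_riemLog (hR i).1 hP⟩⟩)
  refine ⟨w, hw, (hasFDerivAt_weightedVar_zero_iff (fun i => (hR i).1) w hP).2 fun V => ?_⟩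
  rw [h, map_zero, LinearMap.zero_apply]

/-- A singular point off the hypersurface is moved along its ray onto the hypersurface; there the
logarithms span the same affine subspace up to a homothety and a translation. -/
theorem singularSet_subset_SPDLevel (hn : 1 ≤ n) {l : ℕ} [Nonempty (Fin l)] {r : ℝ} (hr : 0 < r)
    {R : Fin l → SymMat n} (hR : ∀ i, R i ∈ SPDLevel n r)
    (hgen : ¬ LieOnExpOfAffine r (n * (n + 1) / 2) R) : singularSet R ⊆ SPDLevel n r := by
  rintro P ⟨hP, hs⟩
  refine ⟨hP, ?_⟩
  by_contra hd
  have hPd : 0 < P.1.det := Matrix.PosDef.det_pos hP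
  have hc : Real.log r - Real.log P.1.det ≠ 0 := fun h =>
    hd (Real.log_injOn_pos hPd hr (by linarith))
  have hlt : Module.finrank ℝ (Submodule.span ℝ (Set.range fun i => riemLog P (R i))) <
      Module.finrank ℝ (SymMat n) := by
    refine lt_of_le_of_ne (Submodule.finrank_le _) fun h => hs ⟨hP, ?_⟩
    rw [h, finrank_symMat]
  have hdim := finrank_direction_of_hyperplane hc (fun i => traceInv_riemLog (hR i) hP) hlt
  -- the scaling factor with `det (t P) = t ^ n * det P = r`
  set t : ℝ := (r / P.1.det) ^ ((n : ℝ)⁻¹)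
  have ht : 0 < t := Real.rpow_pos_of_pos (div_pos hr hPd) _
  have htn : t ^ n = r / P.1.det := Real.rpow_inv_natCast_pow (div_pos hr hPd).le (by omega)
  have htP : t • P ∈ SPDLevel n r := by
    refine ⟨smul_mem_SPD ht hP, ?_⟩
    change (t • P.1).det = r
    rw [Matrix.det_smul, Fintype.card_fin, htn, div_mul_cancel₀ _ hPd.ne']
  let f : SymMat n →ᵃ[ℝ] SymMat n :=
    (t • LinearMap.id : SymMat n →ₗ[ℝ] SymMat n).toAffineMap +
      AffineMap.const ℝ _ (-(t • Real.log t • P))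
  have hf : ∀ V, f V = t • (V - Real.log t • P) := fun V => by
    change t • V + -(t • Real.log t • P) = _
    rw [smul_sub, sub_eq_add_neg]
  refine hgen ⟨t • P, htP, (affineSpan ℝ (Set.range fun i => riemLog P (R i))).map f, ?_,
    fun i => ⟨riemLog (t • P) (R i), ?_, riemExp_riemLog (hR i).1 htP.1⟩⟩
  · rw [AffineSubspace.map_direction]
    rw [finrank_symMat] at hdim
    have := Submodule.finrank_map_le f.linear
      (affineSpan ℝ (Set.range fun i => riemLog P (R i))).direction
    omega
  · rw [riemLog_smul ht (hR i).1 hP, ← hf]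
    exact ⟨_, mem_affineSpan ℝ (Set.mem_range_self i), rfl⟩

/-- On an open set of points where the logarithms have full rank, the Fréchet map is an
immersion. -/
theorem isImmersionOnOpen_frechetMap {l : ℕ} {R : Fin l → SymMat n} (hR : ∀ i, R i ∈ SPD n)
    {U : Set (SymMat n)} (hU : IsOpen U) (hfull : U ⊆ fullRankSet R) :
    IsImmersionOnOpen (frechetMap R) U := by
  refine ⟨hU, ?_, ?_⟩
  · rw [contDiffOn_pi]
    exact fun i P hP => (contDiffAt_riemDist_sq (hR i) (hfull hP).1).contDiffWithinAt
  · intro P hPU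
    obtain ⟨hP, hrank⟩ := hfull hPU
    have hF : HasFDerivAt (frechetMap R)
        (ContinuousLinearMap.pi fun i => fderiv ℝ (fun Q => riemDist (R i) Q ^ 2) P) P :=
      hasFDerivAt_pi.2 fun i => hasFDerivAt_riemDist_sq (hR i) hP
    have hd : ∀ V i, fderiv ℝ (frechetMap R) P V i =
        fderiv ℝ (fun Q => riemDist (R i) Q ^ 2) P V :=
      fun V i => congrFun (DFunLike.congr_fun hF.fderiv V) i
    refine (injective_iff_map_eq_zero _).2 fun V hV => ?_
    have htop : Submodule.span ℝ (Set.range fun i => riemLog P (R i)) = ⊤ :=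
      Submodule.eq_top_of_finrank_eq (by rw [hrank, finrank_symMat])
    refine eq_zero_of_gradForm_eq_zero hP fun X => ?_
    have hle : Submodule.span ℝ (Set.range fun i => riemLog P (R i)) ≤
        LinearMap.ker ((gradForm P).flip V) := by
      rw [Submodule.span_le]
      rintro _ ⟨i, rfl⟩
      have h := congrFun hV i
      exact (fderiv_riemDist_sq_eq_gradForm (hR i) hP V).symm.trans ((hd V i).symm.trans h)
    exact hle (htop ▸ Submodule.mem_top)

theorem continuous_det_symMat : Continuous fun P : SymMat n => P.1.det :=
  continuous_subtype_val.matrix_det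

theorem isOpen_SPDUpper (n : ℕ) (r : ℝ) : IsOpen (SPDUpper n r) :=
  (isOpen_SPD n).inter (isOpen_lt continuous_const continuous_det_symMat)

theorem isOpen_SPDLower (n : ℕ) (r : ℝ) : IsOpen (SPDLower n r) :=
  (isOpen_SPD n).inter (isOpen_lt continuous_det_symMat continuous_const)

end Barycentric

theorem mainTheorem5 (n : ℕ) (hn : 1 ≤ n) (r : ℝ) (hr : 0 < r)
    (R : Fin (n * (n + 1) / 2) → SymMat n) (hR : ∀ i, R i ∈ SPDLevel n r) :
    (EBS R ⊆ SPDLevel n r ∧ SPDLevel n r ⊆ singularSet R) ∧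
    (¬ LieOnExpOfAffine r (n * (n + 1) / 2) R →
      EBS R = SPDLevel n r ∧ SPDLevel n r = singularSet R) ∧
    (EBS R = SPDLevel n r ∧ SPDLevel n r = singularSet R →
      IsImmersionOnOpen (frechetMap R) (SPDUpper n r) ∧
      IsImmersionOnOpen (frechetMap R) (SPDLower n r)) := by
  have hm : 0 < n * (n + 1) / 2 := Nat.div_pos (by nlinarith) two_pos
  have : Nonempty (Fin (n * (n + 1) / 2)) := ⟨⟨0, hm⟩⟩
  have h1 := EBS_subset_SPDLevel hr hR
  have h2 := SPDLevel_subset_singularSet hn hR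
  refine ⟨⟨h1, h2⟩, fun hgen => ⟨h1.antisymm (SPDLevel_subset_EBS hn hR hgen),
    h2.antisymm (singularSet_subset_SPDLevel hn hr hR hgen)⟩, fun ⟨_, hS⟩ => ?_⟩
  have hfull : ∀ P ∈ SPD n, P.1.det ≠ r → P ∈ fullRankSet R := fun P hP hd => by
    by_contra h
    have h3 : P ∈ SPDLevel n r := hS ▸ ⟨hP, h⟩
    exact hd h3.2
  exact ⟨isImmersionOnOpen_frechetMap (fun i => (hR i).1) (isOpen_SPDUpper n r)
      fun P hP => hfull P hP.1 hP.2.ne',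
    isImmersionOnOpen_frechetMap (fun i => (hR i).1) (isOpen_SPDLower n r)
      fun P hP => hfull P hP.1 hP.2.ne⟩
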